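/- Theorem. Let $d\ge 0$ be an integer. A set $\Omega\subset\mathbb R^{d+1}$ with boundary $\Gamma=\partial\Omega$ is called a closed $C^2$-domain if it is the closure of an open, connected, bounded (nonempty) set and there are $\delta>0$, $M>0$ and a finite cover of $\Gamma$ by connected open sets $U_1,\dots,U_J$ such that: (i) for every $x\in\Omega$ with $\operatorname{dist}(x,\Gamma)<\delta$ there is an index $j$ with $x\in U_j$ and $\operatorname{dist}(x,\partial U_j)>\delta$; (ii) for each $j$ there are a Cartesian coordinate system $(\xi_{j,1},\dots,\xi_{j,d+1})$ of $\mathbb R^{d+1}$ and a $C^2$-function $f_j:\mathbb R^d\to\mathbb R$ with $\max_{1\le i,k\le d}\|\partial_i\partial_k f_j\|_\infty\le M$ such that $\Omega\cap U_j$ is the set of points of $U_j$ at which $\xi_{j,d+1}\le f_j(\xi_{j,1},\dots,\xi_{j,d})$. For $\xi,\eta\in\Omega$ put $$\rho_\Omega(\xi,\eta)=\|\xi-\eta\|+\Bigl|\sqrt{\operatorname{dist}(\xi,\Gamma)}-\sqrt{\operatorname{dist}(\eta,\Gamma)}\Bigr| .$$ For every real $\ell>1$ there is a constant $c_0>0$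 depending only on $d$ and $\ell$, and for every closed $C^2$-domain $\Omega\subset\mathbb R^{d+1}$ there is a constant $C>0$ depending only on $d$, $\ell$ and $\Omega$, such that for every positive integer $n$ there exist finitely many points $\xi_1,\dots,\xi_m\in\Omega$ with $\rho_\Omega(\xi_i,\xi_j)\ge \frac1n$ for all $i\ne j$, and real polynomials $P_1,\dots,P_m$ in $d+1$ variables of total degree at most $c_0n$, such that for every $\xi\in\Omega$ $$\sum_{j=1}^m P_j(\xi)=1\qquad\text{and}\qquad |P_j(\xi)|\le C\,\bigl(1+n\rho_\Omega(\xi,\xi_j)\bigr)^{-\ell},\quad j=1,\dots,m .$$ -/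

import Mathlib

/-- `ℝ^(d+1)` with the Euclidean norm. -/
abbrev Space (d : ℕ) : Type := EuclideanSpace ℝ (Fin (d + 1))

/-- The first `d` coordinates of a point of `ℝ^(d+1)`. -/
def horizontal {d : ℕ} (z : Space d) : EuclideanSpace ℝ (Fin d) :=
  WithLp.toLp 2 fun i : Fin d => z i.castSucc

/-- The second order partial derivative `∂ᵢ∂ₖ f` at `x`. -/
noncomputable def secondPartial {d : ℕ} (f : EuclideanSpace ℝ (Fin d) → ℝ) (i k : Fin d)
    (x : EuclideanSpace ℝ (Fin d)) : ℝ :=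
  iteratedFDeriv ℝ 2 f x ![EuclideanSpace.single i 1, EuclideanSpace.single k 1]

/-- In the open set `U` the set `Ω` is the part lying on or below the graph of a `C²` function
with second order partial derivatives bounded by `M`, in a suitable Cartesian coordinate system
(given by a Euclidean isometry `T`, so that the coordinates of `x` are the entries of `T x`). -/
def IsC2Graph {d : ℕ} (Ω U : Set (Space d)) (M : ℝ) : Prop :=
  ∃ (T : Space d ≃ᵃⁱ[ℝ] Space d) (f : EuclideanSpace ℝ (Fin d) → ℝ),
    ContDiff ℝ 2 f ∧
    (∀ (i k : Fin d) (x : EuclideanSpace ℝ (Fin d)), |secondPartial f i k x| ≤ M) ∧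
    ∀ x ∈ U, x ∈ Ω ↔ T x (Fin.last d) ≤ f (horizontal (T x))

/-- The `C²` condition on the boundary `Γ = ∂Ω`. The extended distance is used for
`dist(x, ∂U_j) > δ`, so that the distance to an empty set is infinite. -/
def HasC2Boundary {d : ℕ} (Ω : Set (Space d)) : Prop :=
  ∃ (δ M : ℝ) (J : ℕ) (U : Fin J → Set (Space d)),
    0 < δ ∧ 0 < M ∧
    (∀ j, IsOpen (U j) ∧ IsConnected (U j)) ∧
    frontier Ω ⊆ ⋃ j, U j ∧
    (∀ x ∈ Ω, Metric.infDist x (frontier Ω) < δ →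
      ∃ j, x ∈ U j ∧ ENNReal.ofReal δ < Metric.infEDist x (frontier (U j))) ∧
    ∀ j, IsC2Graph Ω (U j) M

/-- `Ω` is the closure of an open, connected, bounded set, and it has a `C²` boundary. -/
def IsClosedC2Domain {d : ℕ} (Ω : Set (Space d)) : Prop :=
  (∃ W : Set (Space d), IsOpen W ∧ IsConnected W ∧ Bornology.IsBounded W ∧ Ω = closure W) ∧
    HasC2Boundary Ω

/-- The metric `ρ_Ω(ξ, η) = ‖ξ - η‖ + |√dist(ξ, Γ) - √dist(η, Γ)|`, `Γ = ∂Ω`. -/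
noncomputable def domainMetric {d : ℕ} (Ω : Set (Space d)) (ξ η : Space d) : ℝ :=
  ‖ξ - η‖ +
    |Real.sqrt (Metric.infDist ξ (frontier Ω)) - Real.sqrt (Metric.infDist η (frontier Ω))|

/-- The value at the point `ξ` of a polynomial in `d + 1` variables. -/
noncomputable def polyValue {d : ℕ} (P : MvPolynomial (Fin (d + 1)) ℝ) (ξ : Space d) : ℝ :=
  MvPolynomial.eval (fun i => ξ i) P

/-! On `[0, 1]` a partition of unity localized in `√t` comes from a power of the Fejér kernel: its
translates at equally spaced nodes have constant sum, and symmetrized in `x` they are polynomials in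
`t = cos² (x / 2)`, with `√t = |cos (x / 2)|`. What is controlled is a moment: the sum of all `|q
k|`, weighted by a power of `1 + m |√t - τ k|`, is bounded independently of `m`
(`exists_localized_partition`).

Applied to each rescaled coordinate and multiplied out, this localizes in the Euclidean norm. To
localize in the square root of the distance to `Γ` as well, each product is multiplied by the
members of one more partition, evaluated at a quadratic polynomial `G` chosen for that product. A
`C²` boundary has touching balls of fixed radius on both sides. Near a point `z` close to `Γ`, the
distance to the exterior ball at the foot of `z` differs from the distance to `Γ` by `O(‖x - z‖²)`.
Under the square root this is `O(‖x - z‖)`, an error the Euclidean factor absorbs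
(`IsClosedC2Domain.exists_quadratic`).

Sums factor over the product, so the weighted moment of the resulting family is again bounded
(`IsClosedC2Domain.exists_localized_family`). Finally the polynomials are regrouped around a maximal
separated set of their centres. The moment bound survives grouping and dominates each group, so no
points need to be counted (`exists_separated_partition`). -/

/-! ### Fejér kernel, even trigonometric polynomials and equally spaced sums. -/

open Finset in
theorem two_mul_sin_mul_sum_cos (α β : ℝ) (n : ℕ) :
    2 * Real.sin (β / 2) * ∑ k ∈ range n, Real.cos (α + k * β) =
      Real.sin (α + n * β - β / 2) - Real.sin (α - β / 2) := by
  induction n with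
  | zero => simp
  | succ n ih =>
    rw [sum_range_succ, mul_add, ih]
    have h1 : Real.sin (α + (n + 1 : ℕ) * β - β / 2) =
        Real.sin ((α + n * β) + β / 2) := by
      congr 1; push_cast; ring
    have h2 : Real.sin (α + n * β - β / 2) = Real.sin ((α + n * β) - β / 2) := rfl
    rw [h1, h2, Real.sin_add, Real.sin_sub (α + n * β)]
    ring

/-- The Fejér kernel multiplied by `m`. -/
noncomputable def fejer (m : ℕ) (x : ℝ) : ℝ :=
  (∑ j ∈ Finset.range m, Real.cos (j * x)) ^ 2 + (∑ j ∈ Finset.range m, Real.sin (j * x)) ^ 2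

theorem fejer_nonneg (m : ℕ) (x : ℝ) : 0 ≤ fejer m x := by
  unfold fejer; positivity

theorem fejer_neg (m : ℕ) (x : ℝ) : fejer m (-x) = fejer m x := by
  simp [fejer]

theorem fejer_zero (m : ℕ) : fejer m 0 = (m : ℝ) ^ 2 := by
  simp [fejer]

theorem fejer_le_sq (m : ℕ) (x : ℝ) : fejer m x ≤ (m : ℝ) ^ 2 := by
  have h1 := sq_sum_le_card_mul_sum_sq (s := Finset.range m) (f := fun j : ℕ => Real.cos (j * x))
  have h2 := sq_sum_le_card_mul_sum_sq (s := Finset.range m) (f := fun j : ℕ => Real.sin (j * x))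
  have h3 : ∑ j ∈ Finset.range m, Real.cos (j * x) ^ 2
      + ∑ j ∈ Finset.range m, Real.sin (j * x) ^ 2 = m := by
    rw [← Finset.sum_add_distrib]; simp
  rw [Finset.card_range] at h1 h2
  unfold fejer
  calc _ ≤ (m : ℝ) * ∑ j ∈ Finset.range m, Real.cos (j * x) ^ 2
        + m * ∑ j ∈ Finset.range m, Real.sin (j * x) ^ 2 := add_le_add h1 h2
    _ = _ := by rw [← mul_add, h3, sq]

theorem sin_sq_mul_fejer_le (m : ℕ) (x : ℝ) : Real.sin (x / 2) ^ 2 * fejer m x ≤ 1 := by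
  have h1 := two_mul_sin_mul_sum_cos 0 x m
  -- The sine sum is the cosine sum with its phase shifted by `π / 2`.
  have h2 := two_mul_sin_mul_sum_cos (-(Real.pi / 2)) x m
  simp only [neg_add_eq_sub, Real.cos_sub_pi_div_two, zero_add] at h1 h2
  have e1 : Real.sin (m * x - Real.pi / 2 - x / 2) = - Real.cos (m * x - x / 2) := by
    rw [← Real.sin_sub_pi_div_two]; congr 1; ring
  have e2 : Real.sin (-(Real.pi / 2) - x / 2) = - Real.cos (x / 2) := by
    rw [← Real.cos_neg (x / 2), ← Real.sin_sub_pi_div_two]; congr 1; ring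
  rw [e1, e2] at h2
  rw [zero_sub, Real.sin_neg] at h1
  have h3 : 4 * (Real.sin (x / 2) ^ 2 * fejer m x) =
      (Real.sin (m * x - x / 2) - -Real.sin (x / 2)) ^ 2
      + (-Real.cos (m * x - x / 2) - -Real.cos (x / 2)) ^ 2 := by
    rw [← h1, ← h2, fejer]; ring
  nlinarith [Real.sin_sq_add_cos_sq (x / 2), Real.sin_sq_add_cos_sq (m * x - x / 2),
    sq_nonneg (Real.sin (m * x - x / 2) - Real.sin (x / 2)),
    sq_nonneg (Real.cos (m * x - x / 2) + Real.cos (x / 2))]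

theorem fejer_eq_sum_cos (m : ℕ) (x : ℝ) :
    fejer m x = ∑ i ∈ Finset.range m, ∑ j ∈ Finset.range m, Real.cos (((i : ℝ) - j) * x) := by
  simp only [fejer, sq, Finset.sum_mul_sum, ← Finset.sum_add_distrib, sub_mul, Real.cos_sub]

/-- Since `(1 + a)² ≤ 2 + 2 a²`, the bounds for `x` near and away from the peak combine into one. -/
theorem fejer_mul_sq_le (m : ℕ) (x : ℝ) :
    fejer m x * (1 + m * |Real.sin (x / 2)|) ^ 2 ≤ 4 * (m : ℝ) ^ 2 := by
  have h1 := fejer_le_sq m x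
  have h2 := sin_sq_mul_fejer_le m x
  rw [← sq_abs] at h2
  have h0 := fejer_nonneg m x
  have h3 : (m : ℝ) ^ 2 * (|Real.sin (x / 2)| ^ 2 * fejer m x) ≤ (m : ℝ) ^ 2 * 1 :=
    mul_le_mul_of_nonneg_left h2 (by positivity)
  nlinarith [mul_nonneg h0 (sq_nonneg (1 - m * |Real.sin (x / 2)|))]

/-- The weight uses up `p` of the `p + 1` factors. The remaining one is kept because its sum over
equally spaced nodes is known exactly. -/
theorem fejer_pow_mul_le (m p : ℕ) (x : ℝ) :
    fejer m x ^ (p + 1) * (1 + m * |Real.sin (x / 2)|) ^ (2 * p) ≤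
      (4 * (m : ℝ) ^ 2) ^ p * fejer m x := by
  have h0 := fejer_nonneg m x
  calc _ = (fejer m x * (1 + m * |Real.sin (x / 2)|) ^ 2) ^ p * fejer m x := by
        rw [mul_pow, ← pow_mul]; ring
    _ ≤ _ := by
      gcongr ?_ * _
      exact pow_le_pow_left₀ (by positivity) (fejer_mul_sq_le m x) p

/-- The even trigonometric polynomials of degree at most `D`. -/
def cosineSpan (D : ℕ) : Submodule ℝ (ℝ → ℝ) :=
  Submodule.span ℝ ((fun (l : ℕ) (x : ℝ) => Real.cos (l * x)) '' Set.Iic D)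

theorem cos_mem_cosineSpan {l D : ℕ} (h : l ≤ D) :
    (fun x : ℝ => Real.cos (l * x)) ∈ cosineSpan D :=
  Submodule.subset_span ⟨l, h, rfl⟩

theorem cos_int_mem_cosineSpan {l : ℤ} {D : ℕ} (h : l.natAbs ≤ D) :
    (fun x : ℝ => Real.cos (l * x)) ∈ cosineSpan D := by
  convert cos_mem_cosineSpan h using 2 with x
  rw [Nat.cast_natAbs, Int.cast_abs, ← Real.cos_abs, abs_mul, ← Real.cos_abs (|(l : ℝ)| * x),
    abs_mul, abs_abs]

theorem mul_mem_cosineSpan {D E : ℕ} {f g : ℝ → ℝ} (hf : f ∈ cosineSpan D)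
    (hg : g ∈ cosineSpan E) : f * g ∈ cosineSpan (D + E) := by
  induction hf using Submodule.span_induction with
  | zero => simp
  | add _ _ _ _ h1 h2 => rw [add_mul]; exact add_mem h1 h2
  | smul a _ _ h => rw [smul_mul_assoc]; exact Submodule.smul_mem _ _ h
  | mem f hf =>
    obtain ⟨l, hl, rfl⟩ := hf
    induction hg using Submodule.span_induction with
    | zero => simp
    | add _ _ _ _ h1 h2 => rw [mul_add]; exact add_mem h1 h2
    | smul a _ _ h => rw [mul_smul_comm]; exact Submodule.smul_mem _ _ h
    | mem g hg =>
      obtain ⟨k, hk, rfl⟩ := hg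
      rw [Set.mem_Iic] at hl hk
      have h1 : (fun x : ℝ => Real.cos (((l + k : ℕ) : ℤ) * x)) ∈ cosineSpan (D + E) :=
        cos_int_mem_cosineSpan (by omega)
      have h2 : (fun x : ℝ => Real.cos (((l - k : ℤ)) * x)) ∈ cosineSpan (D + E) :=
        cos_int_mem_cosineSpan (by omega)
      convert Submodule.smul_mem _ (1 / 2 : ℝ) (add_mem h1 h2) using 1
      ext x
      simp only [Pi.mul_apply, Pi.smul_apply, Pi.add_apply, smul_eq_mul]
      push_cast
      rw [add_mul, sub_mul, Real.cos_add, Real.cos_sub]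
      ring

theorem fejer_mem_cosineSpan (m : ℕ) : fejer m ∈ cosineSpan m := by
  have : fejer m = ∑ i ∈ Finset.range m, ∑ j ∈ Finset.range m,
      fun x : ℝ => Real.cos (((i - j : ℤ) : ℝ) * x) := by
    ext x
    simp [fejer_eq_sum_cos]
  rw [this]
  refine sum_mem fun i hi => sum_mem fun j hj => cos_int_mem_cosineSpan ?_
  rw [Finset.mem_range] at hi hj
  omega

theorem fejer_pow_mem_cosineSpan (m r : ℕ) : fejer m ^ r ∈ cosineSpan (r * m) := by
  induction r with
  | zero =>
    convert cos_mem_cosineSpan (le_refl (0 * m)) using 1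
    ext x; simp
  | succ r ih =>
    rw [pow_succ, add_mul, one_mul]
    exact mul_mem_cosineSpan ih (fejer_mem_cosineSpan m)

/-- The arguments run through a whole number of periods, so the telescoped right-hand side vanishes;
the sine factor is nonzero because `N` does not divide `l`. -/
theorem sum_cos_equispaced {N : ℕ} {l : ℤ} (h0 : l ≠ 0) (hl : l.natAbs < N) (x : ℝ) :
    ∑ k ∈ Finset.range N, Real.cos (l * (x - 2 * Real.pi * k / N)) = 0 := by
  have hN : (N : ℝ) ≠ 0 := by
    have : N ≠ 0 := by omega
    exact_mod_cast this
  have h := two_mul_sin_mul_sum_cos (l * x) (-(2 * Real.pi * l / N)) N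
  have e1 : Real.sin (l * x + N * -(2 * Real.pi * l / N) - -(2 * Real.pi * l / N) / 2) =
      Real.sin (l * x - -(2 * Real.pi * l / N) / 2) := by
    rw [← Real.sin_sub_int_mul_two_pi (l * x - -(2 * Real.pi * l / N) / 2) l]
    congr 1
    field_simp
    ring
  rw [e1, sub_self] at h
  have hs : Real.sin (-(2 * Real.pi * l / N) / 2) ≠ 0 := by
    rw [Ne, Real.sin_eq_zero_iff]
    rintro ⟨j, hj⟩
    have h1 : (j : ℝ) * N = -l := by
      have := Real.pi_ne_zero
      field_simp at hj
      linarith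
    have h2 : j * (N : ℤ) = -l := by exact_mod_cast h1
    have h3 : (N : ℤ) ∣ l := ⟨-j, by linarith⟩
    have h4 := Nat.le_of_dvd (by omega) (Int.natCast_dvd.mp h3)
    omega
  have h2 := (mul_eq_zero.mp h).resolve_left (by simpa using hs)
  rw [← h2]
  refine Finset.sum_congr rfl fun k _ => ?_
  congr 1
  ring

theorem sum_equispaced_eq {D N : ℕ} {f : ℝ → ℝ} (hf : f ∈ cosineSpan D) (h : D < N) (x : ℝ) :
    ∑ k ∈ Finset.range N, f (x - 2 * Real.pi * k / N) =
      ∑ k ∈ Finset.range N, f (0 - 2 * Real.pi * k / N) := by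
  induction hf using Submodule.span_induction with
  | zero => simp
  | add _ _ _ _ h1 h2 => simp only [Pi.add_apply, Finset.sum_add_distrib, h1, h2]
  | smul a _ _ h => simp only [Pi.smul_apply, ← Finset.smul_sum, h]
  | mem f hf =>
    obtain ⟨l, hl, rfl⟩ := hf
    rw [Set.mem_Iic] at hl
    rcases Nat.eq_zero_or_pos l with rfl | h0
    · simp
    · have h1 := fun y => sum_cos_equispaced (N := N) (l := l) (by omega) (by omega) y
      simp only [Int.cast_natCast] at h1
      rw [h1, h1]

/-- Only the `m` diagonal frequencies `i = j` survive, each contributing `N`. -/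
theorem sum_fejer_equispaced {m N : ℕ} (h : m ≤ N) (x : ℝ) :
    ∑ k ∈ Finset.range N, fejer m (x - 2 * Real.pi * k / N) = N * m := by
  simp only [fejer_eq_sum_cos]
  rw [Finset.sum_comm]
  have : ∀ i ∈ Finset.range m, ∑ k ∈ Finset.range N, ∑ j ∈ Finset.range m,
      Real.cos (((i : ℝ) - j) * (x - 2 * Real.pi * k / N)) = N := by
    intro i hi
    rw [Finset.sum_comm, Finset.sum_eq_single i]
    · simp
    · intro j hj hij
      rw [Finset.mem_range] at hi hj
      have := sum_cos_equispaced (N := N) (l := (i : ℤ) - j) (by omega) (by omega) x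
      simpa using this
    · exact fun h => absurd hi h
  rw [Finset.sum_congr rfl this]
  simp [mul_comm]

/-! ### Localized partition of unity on `[0, 1]`. -/

-- The symmetrization is even in `x`, hence a polynomial in `cos x`: for `cos (l x)` it is `cos (l
-- α) cos (l x)`, a Chebyshev polynomial.
open Polynomial in
theorem exists_polynomial_eval_cos {D : ℕ} {f : ℝ → ℝ} (hf : f ∈ cosineSpan D) (α : ℝ) :
    ∃ q : ℝ[X], q.natDegree ≤ D ∧
      ∀ x, q.eval ((1 + Real.cos x) / 2) = (f (x - α) + f (x + α)) / 2 := by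
  induction hf using Submodule.span_induction with
  | zero => exact ⟨0, by simp, by simp⟩
  | add _ _ _ _ h1 h2 =>
    obtain ⟨q, hq, h1⟩ := h1
    obtain ⟨q', hq', h2⟩ := h2
    refine ⟨q + q', natDegree_add_le_of_degree_le hq hq', fun x => ?_⟩
    rw [eval_add, h1, h2]
    simp only [Pi.add_apply]
    ring
  | smul a _ _ h =>
    obtain ⟨q, hq, h1⟩ := h
    refine ⟨C a * q, (natDegree_C_mul_le _ _).trans hq, fun x => ?_⟩
    rw [eval_mul, eval_C, h1]
    simp only [Pi.smul_apply, smul_eq_mul]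
    ring
  | mem f hf =>
    obtain ⟨l, hl, rfl⟩ := hf
    refine ⟨C (Real.cos (l * α)) * (Chebyshev.T ℝ l).comp (C 2 * X - C 1), ?_, fun x => ?_⟩
    · refine (natDegree_C_mul_le _ _).trans (natDegree_comp_le.trans ?_)
      have h1 : (Chebyshev.T ℝ l).natDegree ≤ l := by
        simp [Chebyshev.natDegree_T]
      have h2 : (C (2 : ℝ) * X - C 1).natDegree ≤ 1 := by compute_degree
      calc _ ≤ l * 1 := Nat.mul_le_mul h1 h2
        _ ≤ D := by simpa using hl
    · simp only [eval_mul, eval_comp, eval_sub, eval_C, eval_X]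
      rw [show 2 * ((1 + Real.cos x) / 2) - 1 = Real.cos x by ring, Chebyshev.T_real_cos,
        mul_sub, mul_add, Real.cos_add, Real.cos_sub]
      push_cast
      ring

/-- Turns decay of the kernel in `|sin ((x - θ) / 2)|` into decay in `|√t - τ|`. -/
theorem abs_abs_cos_sub_abs_cos_le (a b : ℝ) :
    |(|Real.cos a| - |Real.cos b|)| ≤ |Real.sin (a - b)| := by
  have key : ∀ a b : ℝ, |Real.cos a| - |Real.cos b| ≤ |Real.sin (a - b)| := by
    intro a b
    have h : Real.cos a = Real.cos b * Real.cos (a - b) - Real.sin b * Real.sin (a - b) := by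
      rw [← Real.cos_add]; congr 1; ring
    have h1 : |Real.cos b * Real.cos (a - b)| ≤ |Real.cos b| := by
      rw [abs_mul]
      exact mul_le_of_le_one_right (abs_nonneg _) (Real.abs_cos_le_one _)
    have h2 : |Real.sin b * Real.sin (a - b)| ≤ |Real.sin (a - b)| := by
      rw [abs_mul]
      exact mul_le_of_le_one_left (abs_nonneg _) (Real.abs_sin_le_one _)
    have h3 := abs_sub (Real.cos b * Real.cos (a - b)) (Real.sin b * Real.sin (a - b))
    rw [← h] at h3
    linarith
  rw [abs_le]
  refine ⟨?_, key a b⟩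
  have := key b a
  rw [← abs_neg (Real.sin (b - a)), ← Real.sin_neg, neg_sub] at this
  linarith

open Polynomial in
/-- A univariate polynomial partition of unity on `[0, 1]` which is localized at the scale `1 / m`
with respect to `√t`. -/
theorem exists_localized_partition (p m : ℕ) (hm : 1 ≤ m) :
    ∃ (N : ℕ) (q : Fin N → ℝ[X]) (τ : Fin N → ℝ),
      (∀ k, (q k).natDegree ≤ (p + 1) * m) ∧ (∀ k, τ k ∈ Set.Icc (0 : ℝ) 1) ∧
      ∀ t ∈ Set.Icc (0 : ℝ) 1, ∑ k, (q k).eval t = 1 ∧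
        ∑ k, |(q k).eval t| * (1 + m * |√t - τ k|) ^ (2 * p) ≤ 4 ^ p * (p + 2) := by
  -- More nodes than the degree of `K`, so that translates have constant sum, but only `O(m)` of
  -- them, so that moments stay bounded.
  set N := (p + 1) * m + 1 with hN
  have hmN : m ≤ N := by nlinarith
  set K : ℝ → ℝ := fejer m ^ (p + 1) with hK
  have hKmem : K ∈ cosineSpan ((p + 1) * m) := fejer_pow_mem_cosineSpan m (p + 1)
  have hm0 : (0 : ℝ) < m := by exact_mod_cast hm
  have hK0 : ∀ x, 0 ≤ K x := fun x => pow_nonneg (fejer_nonneg m x) _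
  have hKneg : ∀ x, K (-x) = K x := fun x => by simp [hK, fejer_neg]
  set θ : Fin N → ℝ := fun k => 2 * Real.pi * (k : ℕ) / N with hθ
  have sum_eq : ∀ g : ℝ → ℝ, ∀ x, ∑ k : Fin N, g (x - θ k) =
      ∑ k ∈ Finset.range N, g (x - 2 * Real.pi * k / N) := fun g x =>
    Fin.sum_univ_eq_sum_range (fun k : ℕ => g (x - 2 * Real.pi * k / N)) N
  set S := ∑ k : Fin N, K (0 - θ k) with hS
  have hsum : ∀ x, ∑ k : Fin N, K (x - θ k) = S := fun x => by
    rw [hS, sum_eq, sum_eq]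
    exact sum_equispaced_eq hKmem (Nat.lt_succ_self _) x
  -- The node `θ = 0` alone contributes the peak value `K 0`.
  have hSge : ((m : ℝ) ^ 2) ^ (p + 1) ≤ S := by
    have h1 : K (0 - θ ⟨0, by omega⟩) = ((m : ℝ) ^ 2) ^ (p + 1) := by
      simp [hθ, hK, fejer_zero]
    rw [← h1]
    exact Finset.single_le_sum (f := fun k => K (0 - θ k)) (fun k _ => hK0 _) (Finset.mem_univ _)
  have hSpos : 0 < S := lt_of_lt_of_le (by positivity) hSge
  choose Q hQd hQ using fun k : Fin N => exists_polynomial_eval_cos hKmem (θ k)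
  have hmoment : ∀ x, ∑ k, K (x - θ k) * (1 + m * |Real.sin ((x - θ k) / 2)|) ^ (2 * p)
      ≤ 4 ^ p * (p + 2) * S := by
    intro x
    calc _ ≤ ∑ k, (4 * (m : ℝ) ^ 2) ^ p * fejer m (x - θ k) :=
          Finset.sum_le_sum fun k _ => fejer_pow_mul_le m p _
      _ = (4 * (m : ℝ) ^ 2) ^ p * (N * m) := by
          rw [← Finset.mul_sum, sum_eq, sum_fejer_equispaced hmN]
      _ ≤ (4 * (m : ℝ) ^ 2) ^ p * ((p + 2) * m * m) := by
          gcongr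
          have : N ≤ (p + 2) * m := by rw [hN]; nlinarith
          exact_mod_cast this
      _ = 4 ^ p * (p + 2) * ((m : ℝ) ^ 2) ^ (p + 1) := by rw [mul_pow]; ring
      _ ≤ _ := by gcongr
  clear_value K θ S
  refine ⟨N, fun k => C S⁻¹ * Q k, fun k => |Real.cos (θ k / 2)|,
    fun k => (natDegree_C_mul_le _ _).trans (hQd k),
    fun k => ⟨abs_nonneg _, Real.abs_cos_le_one _⟩, fun t ht => ?_⟩
  obtain ⟨x, hx⟩ : ∃ x, Real.cos x = 2 * t - 1 :=
    ⟨Real.arccos (2 * t - 1), Real.cos_arccos (by linarith [ht.1]) (by linarith [ht.2])⟩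
  have ht' : t = (1 + Real.cos x) / 2 := by rw [hx]; ring
  have hsqrt : √t = |Real.cos (x / 2)| := by
    rw [← Real.sqrt_sq_eq_abs, Real.cos_sq, ht']
    congr 1
    rw [show 2 * (x / 2) = x by ring]
    ring
  have hev : ∀ k, (C S⁻¹ * Q k).eval t = S⁻¹ * ((K (x - θ k) + K (-x - θ k)) / 2) := by
    intro k
    rw [eval_mul, eval_C, ht', hQ, show -x - θ k = -(x + θ k) by ring, hKneg]
  -- Both `x` and `-x` represent `t`, so the weight is dominated at each of the two terms of the
  -- symmetrization.
  have hcos : ∀ k, (1 + m * |√t - (|Real.cos (θ k / 2)|)|) ^ (2 * p) ≤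
      (1 + m * |Real.sin ((x - θ k) / 2)|) ^ (2 * p) ∧
      (1 + m * |√t - (|Real.cos (θ k / 2)|)|) ^ (2 * p) ≤
      (1 + m * |Real.sin ((-x - θ k) / 2)|) ^ (2 * p) := by
    intro k
    have h1 := abs_abs_cos_sub_abs_cos_le (x / 2) (θ k / 2)
    have h2 := abs_abs_cos_sub_abs_cos_le (-x / 2) (θ k / 2)
    rw [← sub_div] at h1 h2
    rw [neg_div, Real.cos_neg] at h2
    rw [hsqrt]
    constructor <;> gcongr
  simp only [hev]
  constructor
  · rw [← Finset.mul_sum, ← Finset.sum_div, Finset.sum_add_distrib, hsum, hsum]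
    field_simp
    norm_num
  · calc _ ≤ ∑ k, S⁻¹ / 2 *
          (K (x - θ k) * (1 + m * |Real.sin ((x - θ k) / 2)|) ^ (2 * p) +
            K (-x - θ k) * (1 + m * |Real.sin ((-x - θ k) / 2)|) ^ (2 * p)) := by
          refine Finset.sum_le_sum fun k _ => ?_
          have h1 := mul_le_mul_of_nonneg_left (hcos k).1 (hK0 (x - θ k))
          have h2 := mul_le_mul_of_nonneg_left (hcos k).2 (hK0 (-x - θ k))
          have h3 := hK0 (x - θ k)
          have h4 := hK0 (-x - θ k)
          rw [abs_of_nonneg (by positivity)]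
          calc _ = S⁻¹ / 2 *
              (K (x - θ k) * (1 + m * |√t - (|Real.cos (θ k / 2)|)|) ^ (2 * p) +
              K (-x - θ k) * (1 + m * |√t - (|Real.cos (θ k / 2)|)|) ^ (2 * p)) := by ring
            _ ≤ _ := mul_le_mul_of_nonneg_left (add_le_add h1 h2) (by positivity)
      _ ≤ S⁻¹ / 2 * (4 ^ p * (p + 2) * S + 4 ^ p * (p + 2) * S) := by
          rw [← Finset.mul_sum, Finset.sum_add_distrib]
          exact mul_le_mul_of_nonneg_left (add_le_add (hmoment x) (hmoment (-x))) (by positivity)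
      _ = _ := by field_simp; norm_num

/-! ### Touching balls of a `C²` domain. -/

theorem IsPreconnected.subset_of_disjoint_frontier {X : Type*} [TopologicalSpace X] {A S : Set X}
    (hA : IsPreconnected A) (hAS : (A ∩ S).Nonempty) (h : Disjoint A (frontier S)) : A ⊆ S := by
  have hsub : A ⊆ interior S ∪ (closure S)ᶜ := by
    intro x hx
    by_contra hc
    rw [Set.mem_union, not_or, Set.notMem_compl_iff] at hc
    exact Set.disjoint_left.mp h hx ⟨hc.2, hc.1⟩
  refine (IsPreconnected.subset_left_of_subset_union isOpen_interior isClosed_closure.isOpen_compl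
    ?_ hsub ?_ hA).trans interior_subset
  · exact disjoint_compl_right.mono_left (interior_subset.trans subset_closure)
  · obtain ⟨x, hx, hxS⟩ := hAS
    exact ⟨x, hx, (hsub hx).resolve_right fun hc => hc (subset_closure hxS)⟩

/-- The second order Taylor bound given by a bound on the second order partial derivatives. -/
theorem abs_sub_sub_fderiv_le {d : ℕ} {f : EuclideanSpace ℝ (Fin d) → ℝ} (hf : ContDiff ℝ 2 f)
    {M : ℝ} (hM0 : 0 ≤ M) (hM : ∀ i k x, |secondPartial f i k x| ≤ M)
    (u v : EuclideanSpace ℝ (Fin d)) :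
    |f v - f u - fderiv ℝ f u (v - u)| ≤ d * d * M * ‖v - u‖ ^ 2 := by
  have hf' : ContDiff ℝ 1 (fderiv ℝ f) := hf.fderiv_right (by norm_num)
  have hsum : ∀ w : EuclideanSpace ℝ (Fin d), w = ∑ i, w i • EuclideanSpace.single i (1 : ℝ) := by
    intro w
    have := (EuclideanSpace.basisFun (Fin d) ℝ).sum_repr w
    simpa using this.symm
  have hD : ∀ x, ‖fderiv ℝ (fderiv ℝ f) x‖ ≤ d * d * M := by
    intro x
    refine ContinuousLinearMap.opNorm_le_bound _ (by positivity) fun v => ?_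
    refine ContinuousLinearMap.opNorm_le_bound _ (by positivity) fun w => ?_
    have h1 : fderiv ℝ (fderiv ℝ f) x v w = ∑ i, ∑ k, v i * w k * secondPartial f i k x := by
      conv_lhs => rw [hsum v, hsum w]
      simp only [map_sum, sum_apply, map_smul, smul_apply,
        smul_eq_mul, secondPartial, iteratedFDeriv_two_apply, Finset.mul_sum]
      rw [Finset.sum_comm]
      refine Finset.sum_congr rfl fun i _ => Finset.sum_congr rfl fun k _ => ?_
      simp only [Matrix.cons_val_zero, Matrix.cons_val_one]
      ring
    rw [h1]
    calc _ ≤ ∑ i : Fin d, ∑ k : Fin d, ‖v‖ * ‖w‖ * M := by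
          refine (norm_sum_le _ _).trans (Finset.sum_le_sum fun i _ => ?_)
          refine (norm_sum_le _ _).trans (Finset.sum_le_sum fun k _ => ?_)
          rw [norm_mul, norm_mul]
          gcongr
          · exact PiLp.norm_apply_le v i
          · exact PiLp.norm_apply_le w k
          · exact hM i k x
      _ = _ := by simp; ring
  have hlip : ∀ x, ‖fderiv ℝ f x - fderiv ℝ f u‖ ≤ d * d * M * ‖x - u‖ := fun x =>
    convex_univ.norm_image_sub_le_of_norm_fderiv_le (𝕜 := ℝ)
      (fun y _ => (hf'.differentiable (by norm_num)) y) (fun y _ => hD y) trivial trivial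
  -- On this ball the derivative varies by at most `d² M ‖v - u‖`; the Taylor factor `1 / 2` is
  -- given up.
  have h := (convex_closedBall u ‖v - u‖).norm_image_sub_le_of_norm_fderiv_le' (𝕜 := ℝ) (f := f)
    (φ := fderiv ℝ f u) (C := d * d * M * ‖v - u‖) (x := u) (y := v)
    (fun y _ => (hf.differentiable (by norm_num)) y)
    (fun y hy => (hlip y).trans (by gcongr; simpa [dist_eq_norm] using hy))
    (by simp) (by simp [dist_eq_norm])
  rw [Real.norm_eq_abs] at h
  linarith [h]

/-- `horizontal` as a continuous linear map. -/
noncomputable def horizontalCLM (d : ℕ) : Space d →L[ℝ] EuclideanSpace ℝ (Fin d) :=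
  LinearMap.toContinuousLinearMap
    { toFun := horizontal
      map_add' := fun _ _ => rfl
      map_smul' := fun _ _ => rfl }

theorem norm_horizontal_le {d : ℕ} (z : Space d) : ‖horizontal z‖ ≤ ‖z‖ := by
  rw [← sq_le_sq₀ (norm_nonneg _) (norm_nonneg _), EuclideanSpace.norm_sq_eq,
    EuclideanSpace.norm_sq_eq, Fin.sum_univ_castSucc]
  exact le_add_of_nonneg_right (by positivity)

/-- Balls of radius `r` touch the boundary of `Ω` from both sides. -/
def HasTouchingBalls {d : ℕ} (Ω : Set (Space d)) (r : ℝ) : Prop :=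
  ∀ ζ ∈ frontier Ω, ∃ ν : Space d, ‖ν‖ = 1 ∧ Metric.ball (ζ - r • ν) r ⊆ Ω ∧
    Disjoint (Metric.ball (ζ + r • ν) r) Ω

/-- A graph of a `C²` function is separated near each of its points by a tangential functional,
up to a quadratic error. -/
theorem exists_normal_of_graph {d : ℕ} {Ω : Set (Space d)} (hΩ : IsClosed Ω)
    {T : Space d ≃ᵃⁱ[ℝ] Space d} {f : EuclideanSpace ℝ (Fin d) → ℝ} (hf : ContDiff ℝ 2 f) {M : ℝ}
    (hM0 : 0 ≤ M) (hM : ∀ i k x, |secondPartial f i k x| ≤ M) {ζ : Space d} (hζ : ζ ∈ frontier Ω)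
    {δ : ℝ} (hδ : 0 < δ)
    (hT : ∀ x ∈ Metric.ball ζ δ, x ∈ Ω ↔ T x (Fin.last d) ≤ f (horizontal (T x))) :
    ∃ ν : Space d, ‖ν‖ = 1 ∧ ∀ x ∈ Metric.ball ζ δ,
      (d * d * M * ‖x - ζ‖ ^ 2 < inner ℝ ν (x - ζ) → x ∉ Ω) ∧
      (d * d * M * ‖x - ζ‖ ^ 2 < -inner ℝ ν (x - ζ) → x ∈ Ω) := by
  set u₀ := horizontal (T ζ) with hu₀
  have hcontL : Continuous fun x : Space d => T x (Fin.last d) := by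
    have := T.continuous
    fun_prop
  have hcontH : Continuous fun x : Space d => f (horizontal (T x)) :=
    hf.continuous.comp ((horizontalCLM d).continuous.comp T.continuous)
  have hζΩ : ζ ∈ Ω := hΩ.frontier_subset hζ
  have hgraph : T ζ (Fin.last d) = f u₀ := by
    refine le_antisymm ((hT ζ (Metric.mem_ball_self hδ)).1 hζΩ) (not_lt.mp fun hlt => ?_)
    have h1 : ∀ᶠ x in nhds ζ, x ∈ Ω := by
      filter_upwards [Metric.ball_mem_nhds ζ hδ,
        hcontL.continuousAt.eventually_lt hcontH.continuousAt hlt] with x hx hx'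
      exact (hT x hx).2 hx'.le
    exact hζ.2 (mem_interior_iff_mem_nhds.2 h1)
  -- The differential at `T ζ` of height minus `f`; its gradient `N` is normal to the graph.
  set φ : StrongDual ℝ (Space d) :=
    EuclideanSpace.proj (Fin.last d) - (fderiv ℝ f u₀).comp (horizontalCLM d) with hφ
  have hφ_apply : ∀ w, φ w = w (Fin.last d) - fderiv ℝ f u₀ (horizontal w) := fun w => rfl
  set N := (InnerProductSpace.toDual ℝ (Space d)).symm φ with hN
  have hNφ : ∀ w, inner ℝ N w = φ w := fun w => InnerProductSpace.toDual_symm_apply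
  -- The vertical component of `N` is `1`. Hence normalizing only shrinks the linear term, and the
  -- Taylor error needs no new constant.
  have hN1 : 1 ≤ ‖N‖ := by
    have h1 := real_inner_le_norm N (EuclideanSpace.single (Fin.last d) (1 : ℝ))
    have h2 : horizontal (EuclideanSpace.single (Fin.last d) (1 : ℝ)) = 0 := by
      ext i
      simp [horizontal, Fin.castSucc_ne_last]
    rw [hNφ, hφ_apply, h2] at h1
    simpa using h1
  have hN0 : 0 < ‖N‖ := by linarith
  set A := T.linearIsometryEquiv with hA
  have hAx : ∀ x, A (x - ζ) = T x - T ζ := fun x => by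
    simpa using T.map_vsub x ζ
  refine ⟨A.symm (‖N‖⁻¹ • N), ?_, fun x hx => ?_⟩
  · rw [LinearIsometryEquiv.norm_map, norm_smul, norm_inv, norm_norm, inv_mul_cancel₀ hN0.ne']
  have hinner : inner ℝ (A.symm (‖N‖⁻¹ • N)) (x - ζ) = ‖N‖⁻¹ * φ (T x - T ζ) := by
    rw [LinearIsometryEquiv.inner_map_eq_flip, LinearIsometryEquiv.symm_symm, hAx,
      real_inner_smul_left, hNφ]
  have htaylor := abs_sub_sub_fderiv_le hf hM0 hM u₀ (horizontal (T x))
  have hsub : horizontal (T x) - u₀ = horizontal (T x - T ζ) := rfl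
  have hnorm : ‖horizontal (T x - T ζ)‖ ≤ ‖x - ζ‖ := by
    refine (norm_horizontal_le _).trans (le_of_eq ?_)
    rw [← hAx, LinearIsometryEquiv.norm_map]
  have hrem : |f (horizontal (T x)) - f u₀ - fderiv ℝ f u₀ (horizontal (T x - T ζ))| ≤
      d * d * M * ‖x - ζ‖ ^ 2 := by
    rw [hsub] at htaylor
    refine htaylor.trans ?_
    gcongr
  have hval : φ (T x - T ζ) = T x (Fin.last d) - f u₀
      - fderiv ℝ f u₀ (horizontal (T x - T ζ)) := by
    rw [hφ_apply, ← hgraph]; rfl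
  rw [abs_le] at hrem
  have h0 : 0 ≤ d * d * M * ‖x - ζ‖ ^ 2 := by positivity
  have hinv : ‖N‖⁻¹ ≤ 1 := inv_le_one_of_one_le₀ hN1
  have hinv0 : 0 < ‖N‖⁻¹ := inv_pos.2 hN0
  rw [hinner, hT x hx]
  constructor
  · intro h
    have h1 : 0 < φ (T x - T ζ) := pos_of_mul_pos_right (h0.trans_lt h) hinv0.le
    have h2 : ‖N‖⁻¹ * φ (T x - T ζ) ≤ φ (T x - T ζ) := mul_le_of_le_one_left h1.le hinv
    rw [not_le]
    linarith
  · intro h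
    rw [← mul_neg] at h
    have h1 : 0 < -φ (T x - T ζ) := pos_of_mul_pos_right (h0.trans_lt h) hinv0.le
    have h2 : ‖N‖⁻¹ * -φ (T x - T ζ) ≤ -φ (T x - T ζ) := mul_le_of_le_one_left h1.le hinv
    linarith

theorem IsClosedC2Domain.isClosed {d : ℕ} {Ω : Set (Space d)} (h : IsClosedC2Domain Ω) :
    IsClosed Ω := by
  obtain ⟨⟨W, -, -, -, rfl⟩, -⟩ := h
  exact isClosed_closure

theorem IsClosedC2Domain.isCompact {d : ℕ} {Ω : Set (Space d)} (h : IsClosedC2Domain Ω) :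
    IsCompact Ω := by
  obtain ⟨⟨W, -, -, hW, rfl⟩, -⟩ := h
  exact hW.isCompact_closure

theorem IsClosedC2Domain.nonempty {d : ℕ} {Ω : Set (Space d)} (h : IsClosedC2Domain Ω) :
    Ω.Nonempty := by
  obtain ⟨⟨W, -, hW, -, rfl⟩, -⟩ := h
  exact hW.nonempty.closure

theorem IsClosedC2Domain.frontier_nonempty {d : ℕ} {Ω : Set (Space d)} (h : IsClosedC2Domain Ω) :
    (frontier Ω).Nonempty :=
  nonempty_frontier_iff.2 ⟨h.nonempty, h.isCompact.ne_univ⟩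

/-- In a ball of radius `r` touching `ζ` in direction `η`, `‖x - ζ‖² < 2 r ⟨η, x - ζ⟩`, so for small
`r` the linear term beats the quadratic error of the graph. -/
theorem IsClosedC2Domain.exists_hasTouchingBalls {d : ℕ} {Ω : Set (Space d)}
    (h : IsClosedC2Domain Ω) : ∃ r : ℝ, 0 < r ∧ HasTouchingBalls Ω r := by
  obtain ⟨-, δ, M, J, U, hδ, hM, hU, -, hcov, hgraph⟩ := id h
  set B : ℝ := d * d * M with hB
  have hB0 : 0 ≤ B := by positivity
  -- The radius meets two demands: `2 r B ≤ 1` beats the Taylor error, and `2 r ≤ δ` keeps the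
  -- touching balls where the graph describes `Ω`.
  have hBr : 2 * (δ / (2 * (1 + B * δ))) * B ≤ 1 := by
    rw [mul_div_assoc', div_mul_eq_mul_div, div_le_one (by positivity)]
    nlinarith [mul_nonneg hB0 hδ.le]
  have hrδ : 2 * (δ / (2 * (1 + B * δ))) ≤ δ := by
    rw [mul_div_assoc', div_le_iff₀ (by positivity)]
    nlinarith [mul_nonneg hδ.le (mul_nonneg hB0 hδ.le)]
  have hr0 : 0 < δ / (2 * (1 + B * δ)) := by positivity
  generalize δ / (2 * (1 + B * δ)) = r at *
  refine ⟨r, hr0, fun ζ hζ => ?_⟩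
  obtain ⟨j, hj, hdist⟩ := hcov ζ (h.isClosed.frontier_subset hζ)
    (by rwa [Metric.infDist_zero_of_mem hζ])
  obtain ⟨T, f, hf, hfM, hT⟩ := hgraph j
  have hball : Metric.ball ζ δ ⊆ U j := by
    refine (convex_ball ζ δ).isPreconnected.subset_of_disjoint_frontier
      ⟨ζ, Metric.mem_ball_self hδ, hj⟩ (Set.disjoint_left.2 fun x hx hxU => ?_)
    have h1 := Metric.infEDist_le_edist_of_mem (x := ζ) hxU
    rw [edist_dist] at h1
    have h2 := (ENNReal.ofReal_lt_ofReal_iff_of_nonneg hδ.le).1 (hdist.trans_le h1)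
    rw [Metric.mem_ball, dist_comm] at hx
    linarith
  obtain ⟨ν, hν, hsep⟩ := exists_normal_of_graph h.isClosed hf hM.le hfM hζ hδ
    fun x hx => hT x (hball hx)
  have key : ∀ (x η : Space d), ‖η‖ = 1 → x ∈ Metric.ball (ζ + r • η) r →
      x ∈ Metric.ball ζ δ ∧ d * d * M * ‖x - ζ‖ ^ 2 < inner ℝ η (x - ζ) := by
    intro x η hη hx
    rw [Metric.mem_ball, dist_eq_norm, ← sub_sub] at hx
    constructor
    · rw [Metric.mem_ball, dist_eq_norm]
      have h1 := norm_add_le (x - ζ - r • η) (r • η)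
      rw [sub_add_cancel, norm_smul, hη, Real.norm_of_nonneg hr0.le] at h1
      linarith
    · have h1 := norm_sub_sq_real (x - ζ) (r • η)
      rw [norm_smul, hη, Real.norm_of_nonneg hr0.le, inner_smul_right, real_inner_comm] at h1
      have h2 : ‖x - ζ - r • η‖ ^ 2 < r ^ 2 := by gcongr
      have h3 : 2 * r * (B * ‖x - ζ‖ ^ 2) ≤ ‖x - ζ‖ ^ 2 := by
        nlinarith [mul_le_mul_of_nonneg_right hBr (sq_nonneg ‖x - ζ‖)]
      have h4 : 2 * r * (B * ‖x - ζ‖ ^ 2) < 2 * r * inner ℝ η (x - ζ) := by nlinarith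
      exact lt_of_mul_lt_mul_left h4 (by positivity)
  refine ⟨ν, hν, fun x hx => ?_, Set.disjoint_left.2 fun x hx => ?_⟩
  · obtain ⟨h1, h2⟩ := key x (-ν) (by rwa [norm_neg]) (by rwa [smul_neg, ← sub_eq_add_neg])
    rw [inner_neg_left] at h2
    exact (hsep x h1).2 h2
  · obtain ⟨h1, h2⟩ := key x ν hν hx
    exact (hsep x h1).1 h2

/-! ### Comparing the distance to the boundary with a quadratic polynomial. -/

theorem ball_infDist_frontier_subset {d : ℕ} {Ω : Set (Space d)} {x : Space d} (hx : x ∈ Ω) :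
    Metric.ball x (Metric.infDist x (frontier Ω)) ⊆ Ω := by
  rcases (Metric.infDist_nonneg (x := x) (s := frontier Ω)).eq_or_lt with h | h
  · rw [← h, Metric.ball_zero]; exact Set.empty_subset _
  · exact (convex_ball x _).isPreconnected.subset_of_disjoint_frontier
      ⟨x, Metric.mem_ball_self h, hx⟩ Metric.disjoint_ball_infDist

/-- The ball about `x` reaching to the boundary stays in `Ω`, hence is disjoint from the exterior
ball, and disjoint balls have centres at least the sum of the radii apart. -/
theorem infDist_frontier_add_le {d : ℕ} {Ω : Set (Space d)} {x c : Space d} {r : ℝ} (hr : 0 < r)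
    (hx : x ∈ Ω) (hc : Disjoint (Metric.ball c r) Ω) :
    Metric.infDist x (frontier Ω) + r ≤ ‖x - c‖ := by
  rw [← dist_eq_norm]
  rcases (Metric.infDist_nonneg (x := x) (s := frontier Ω)).eq_or_lt with h | h
  · rw [← h, zero_add]
    exact not_lt.1 fun hlt => Set.disjoint_left.1 hc hlt hx
  · exact (disjoint_ball_ball_iff h hr).1 (hc.symm.mono_left (ball_infDist_frontier_subset hx))

theorem le_infDist_frontier_add {d : ℕ} {Ω : Set (Space d)} {x c : Space d} {r : ℝ}
    (hΓ : (frontier Ω).Nonempty) (hc : Metric.ball c r ⊆ Ω) :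
    r ≤ Metric.infDist x (frontier Ω) + ‖x - c‖ := by
  rw [← sub_le_iff_le_add, Metric.le_infDist hΓ]
  intro y hy
  have h1 : r ≤ dist y c :=
    not_lt.1 fun hlt => hy.2 (interior_maximal hc Metric.isOpen_ball hlt)
  have h2 := dist_triangle y x c
  rw [dist_comm y x, dist_eq_norm x c] at h2
  linarith

/-- The norm of a vector is at most its second order expansion along a unit direction. -/
theorem norm_sub_smul_le {d : ℕ} (b ν : Space d) (hν : ‖ν‖ = 1) {a : ℝ} (ha : 0 < a) :
    ‖b - a • ν‖ ≤ a - inner ℝ ν b + ‖b‖ ^ 2 / (2 * a) := by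
  have h1 := norm_sub_sq_real b (a • ν)
  rw [norm_smul, hν, Real.norm_of_nonneg ha.le, inner_smul_right, real_inner_comm] at h1
  have h2 : ‖b - a • ν‖ * (2 * a) ≤ (a - inner ℝ ν b + ‖b‖ ^ 2 / (2 * a)) * (2 * a) := by
    have h3 : ‖b‖ ^ 2 / (2 * a) * (2 * a) = ‖b‖ ^ 2 := by field_simp
    nlinarith [sq_nonneg (‖b - a • ν‖ - a)]
  exact le_of_mul_le_mul_right h2 (by positivity)

/-- Near the boundary, the distance to the boundary agrees with the distance to a touching
exterior ball up to a quadratic error. -/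
theorem HasTouchingBalls.exists_center {d : ℕ} {Ω : Set (Space d)} {r : ℝ} (hr : 0 < r)
    (hT : HasTouchingBalls Ω r) (hΓ : (frontier Ω).Nonempty) {z : Space d} (hz : z ∈ Ω)
    (hzr : Metric.infDist z (frontier Ω) ≤ r / 2) :
    ∃ c : Space d, ‖z - c‖ ≤ 2 * r ∧ ∀ x ∈ Ω,
      Metric.infDist x (frontier Ω) + r ≤ ‖x - c‖ ∧
      ‖x - c‖ ≤ Metric.infDist x (frontier Ω) + r + 3 / (2 * r) * ‖x - z‖ ^ 2 := by
  obtain ⟨ζ, hζ, hzζ⟩ := isClosed_frontier.exists_infDist_eq_dist hΓ z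
  obtain ⟨ν, hν, hin, hout⟩ := hT ζ hζ
  set s := Metric.infDist z (frontier Ω) with hs
  have hs0 : 0 ≤ s := Metric.infDist_nonneg
  rw [dist_eq_norm] at hzζ
  -- The exterior ball forces `s + r ≤ ‖z - ζ - r ν‖` while `‖z - ζ‖ = s`: this is equality in the
  -- triangle inequality, so `z` lies on the normal at its foot `ζ`.
  have hline : z - ζ + s • ν = 0 := by
    have h1 := infDist_frontier_add_le hr hz hout
    rw [← hs, ← sub_sub] at h1
    have h2 := norm_sub_sq_real (z - ζ) (r • ν)
    have h3 := norm_add_sq_real (z - ζ) (s • ν)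
    rw [norm_smul, hν, Real.norm_of_nonneg hr.le, inner_smul_right, ← hzζ] at h2
    rw [norm_smul, hν, Real.norm_of_nonneg hs0, inner_smul_right, ← hzζ] at h3
    have h4 : (s + r) ^ 2 ≤ ‖z - ζ - r • ν‖ ^ 2 := by gcongr
    have h5 : 2 * r * inner ℝ (z - ζ) ν ≤ 2 * r * (-s) := by nlinarith
    have h6 : inner ℝ (z - ζ) ν ≤ -s := le_of_mul_le_mul_left h5 (by positivity)
    have h7 : ‖z - ζ + s • ν‖ ^ 2 ≤ 0 := by nlinarith
    exact norm_eq_zero.1 (pow_eq_zero_iff two_ne_zero |>.1 (le_antisymm h7 (by positivity)))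
  have hζz : ζ = z + s • ν := by
    rw [sub_add_eq_add_sub, sub_eq_zero] at hline
    exact hline.symm
  refine ⟨ζ + r • ν, ?_, fun x hx => ⟨infDist_frontier_add_le hr hx hout, ?_⟩⟩
  · rw [hζz, add_assoc, ← add_smul, sub_add_cancel_left, norm_neg, norm_smul, hν,
      Real.norm_of_nonneg (by positivity)]
    linarith
  -- The distances to the exterior and interior centres are expanded about `z`. Their linear terms
  -- are opposite and cancel in the sum. As `s ≤ r / 2`, the quadratic terms total at most `1 / (2
  -- r) + 1 / r` times `‖x - z‖²`.
  · have h1 := le_infDist_frontier_add (x := x) hΓ hin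
    have h2 := norm_sub_smul_le (x - z) ν hν (a := s + r) (by positivity)
    have h3 := norm_sub_smul_le (x - z) (-ν) (by rwa [norm_neg]) (a := r - s) (by linarith)
    have e2 : x - z - (s + r) • ν = x - (ζ + r • ν) := by rw [hζz]; module
    have e3 : x - z - (r - s) • (-ν) = x - (ζ - r • ν) := by rw [hζz]; module
    rw [e2] at h2
    rw [e3, inner_neg_left] at h3
    have h4 : ‖x - z‖ ^ 2 / (2 * (s + r)) ≤ ‖x - z‖ ^ 2 / (2 * r) := by gcongr; linarith
    have h5 : ‖x - z‖ ^ 2 / (2 * (r - s)) ≤ ‖x - z‖ ^ 2 / (2 * (r / 2)) := by gcongr; linarith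
    have h6 : ‖x - z‖ ^ 2 / (2 * r) + ‖x - z‖ ^ 2 / (2 * (r / 2)) =
        3 / (2 * r) * ‖x - z‖ ^ 2 := by field_simp; norm_num
    linarith

theorem abs_sqrt_sub_sqrt_le_sqrt_sub {a b : ℝ} (hb : 0 ≤ b) (h : b ≤ a) :
    |√a - √b| ≤ √(a - b) := by
  rw [abs_of_nonneg (sub_nonneg.2 (Real.sqrt_le_sqrt h)), sub_le_iff_le_add]
  refine Real.sqrt_le_iff.2 ⟨by positivity, ?_⟩
  nlinarith [Real.sq_sqrt hb, Real.sq_sqrt (sub_nonneg.2 h), Real.sqrt_nonneg (a - b),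
    Real.sqrt_nonneg b, mul_nonneg (Real.sqrt_nonneg (a - b)) (Real.sqrt_nonneg b)]

theorem abs_sqrt_sub_sqrt_mul_sqrt_le {a b : ℝ} (ha : 0 ≤ a) (hb : 0 ≤ b) :
    |√a - √b| * √a ≤ |a - b| := by
  have h : a - b = (√a - √b) * (√a + √b) := by
    nlinarith [Real.sq_sqrt ha, Real.sq_sqrt hb]
  rw [h, abs_mul, abs_of_nonneg (a := √a + √b) (by positivity)]
  gcongr
  linarith [Real.sqrt_nonneg b]

/-- For `a = ‖x - c‖ - r` and `s = 2 r` the product `a (a + s)` is `‖x - c‖² - r²`, a polynomial in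
`x`, which `‖x - c‖ - r` is not. -/
theorem mul_abs_sqrt_sub_sqrt_le {a b s : ℝ} (ha : 0 ≤ a) (hb : 0 ≤ b) :
    √s * |√a - √b| ≤ |√(a * (a + s)) - √(b * (b + s))| := by
  wlog hab : b ≤ a generalizing a b
  · rw [abs_sub_comm, abs_sub_comm (√(a * (a + s)))]
    exact this hb ha (le_of_not_ge hab)
  have h1 : √b ≤ √a := Real.sqrt_le_sqrt hab
  have h2 : √(b + s) ≤ √(a + s) := Real.sqrt_le_sqrt (by linarith)
  have h3 : √s ≤ √(a + s) := Real.sqrt_le_sqrt (by linarith)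
  rw [abs_of_nonneg (sub_nonneg.2 h1), Real.sqrt_mul ha, Real.sqrt_mul hb]
  refine le_trans ?_ (le_abs_self _)
  nlinarith [mul_le_mul_of_nonneg_right h3 (sub_nonneg.2 h1),
    mul_le_mul_of_nonneg_left h2 (Real.sqrt_nonneg b)]

open MvPolynomial in
/-- The polynomial `(‖x - c‖² - r²) / R`. -/
noncomputable def sphericalPolynomial {d : ℕ} (c : Space d) (r R : ℝ) :
    MvPolynomial (Fin (d + 1)) ℝ :=
  C R⁻¹ * (∑ i, (X i - C (c i)) ^ 2 - C (r ^ 2))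

open MvPolynomial in
theorem totalDegree_sphericalPolynomial_le {d : ℕ} (c : Space d) (r R : ℝ) :
    (sphericalPolynomial c r R).totalDegree ≤ 2 := by
  refine (totalDegree_mul _ _).trans ?_
  rw [totalDegree_C, zero_add]
  refine (totalDegree_sub _ _).trans (max_le ?_ (by rw [totalDegree_C]; omega))
  refine totalDegree_finsetSum_le fun i _ => ?_
  refine (totalDegree_pow _ _).trans ?_
  have : (X i - C (c i) : MvPolynomial (Fin (d + 1)) ℝ).totalDegree ≤ 1 :=
    (totalDegree_sub _ _).trans (max_le (by simp) (by simp))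
  omega

theorem polyValue_sphericalPolynomial {d : ℕ} (c x : Space d) (r R : ℝ) :
    polyValue (sphericalPolynomial c r R) x = (‖x - c‖ ^ 2 - r ^ 2) / R := by
  rw [EuclideanSpace.norm_sq_eq, polyValue, sphericalPolynomial]
  simp [div_eq_inv_mul]

theorem abs_infDist_sub_infDist_le {d : ℕ} (S : Set (Space d)) (x y : Space d) :
    |Metric.infDist x S - Metric.infDist y S| ≤ ‖x - y‖ := by
  have := (Metric.lipschitz_infDist_pt S).dist_le_mul x y
  simpa [Real.dist_eq, dist_eq_norm] using this

/-- Near each point `z` of the domain, the square root of the distance to the boundary is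
controlled by the square root of a nonnegative quadratic polynomial. -/
theorem IsClosedC2Domain.exists_quadratic {d : ℕ} {Ω : Set (Space d)} (h : IsClosedC2Domain Ω) :
    ∃ C : ℝ, 0 < C ∧ ∀ z ∈ Ω, ∃ G : MvPolynomial (Fin (d + 1)) ℝ, G.totalDegree ≤ 2 ∧
      (∀ x ∈ Ω, polyValue G x ∈ Set.Icc (0 : ℝ) 1) ∧
      ∀ x ∈ Ω, ∀ y ∈ Ω, |√(Metric.infDist x (frontier Ω)) - √(Metric.infDist y (frontier Ω))| ≤
        C * (|√(polyValue G x) - √(polyValue G y)| + ‖x - z‖ + ‖y - z‖) := by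
  obtain ⟨r, hr, hT⟩ := h.exists_hasTouchingBalls
  obtain ⟨D, hD⟩ := h.isCompact.isBounded.exists_norm_le
  obtain ⟨x₀, hx₀⟩ := h.nonempty
  have hD0 : 0 ≤ D := (norm_nonneg _).trans (hD x₀ hx₀)
  -- Bounds `‖x - c‖²` on `Ω`, so that dividing by `R` brings the polynomial into `[0, 1]`.
  set R : ℝ := (2 * D + 2 * r) ^ 2 with hR
  have hR0 : 0 < R := by positivity
  set C₁ := √(3 / (2 * r)) with hC₁
  set C₂ := √R / √(2 * r) with hC₂
  set C₃ := 1 / √(r / 2) with hC₃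
  have hC₁0 : 0 < C₁ := Real.sqrt_pos.2 (by positivity)
  have hC₂0 : 0 < C₂ := div_pos (Real.sqrt_pos.2 hR0) (Real.sqrt_pos.2 (by positivity))
  have hC₃0 : 0 < C₃ := one_div_pos.2 (Real.sqrt_pos.2 (by positivity))
  refine ⟨C₁ + C₂ + C₃, by positivity, fun z hz => ?_⟩
  rcases le_or_gt (Metric.infDist z (frontier Ω)) (r / 2) with hzr | hzr
  · obtain ⟨c, hzc, hc⟩ := hT.exists_center hr h.frontier_nonempty hz hzr
    have hval : ∀ x, polyValue (sphericalPolynomial c r R) x =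
        (‖x - c‖ - r) * ((‖x - c‖ - r) + 2 * r) / R := fun x => by
      rw [polyValue_sphericalPolynomial]; ring
    have he0 : ∀ x ∈ Ω, 0 ≤ ‖x - c‖ - r := fun x hx => by
      have := (hc x hx).1
      linarith [Metric.infDist_nonneg (x := x) (s := frontier Ω)]
    have herr : ∀ x ∈ Ω, |√(Metric.infDist x (frontier Ω)) - √(‖x - c‖ - r)| ≤
        C₁ * ‖x - z‖ := by
      intro x hx
      obtain ⟨h1, h2⟩ := hc x hx
      rw [abs_sub_comm]
      refine (abs_sqrt_sub_sqrt_le_sqrt_sub Metric.infDist_nonneg (by linarith)).trans ?_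
      rw [← Real.sqrt_sq (norm_nonneg (x - z)), ← Real.sqrt_mul (by positivity)]
      exact Real.sqrt_le_sqrt (by linarith)
    refine ⟨sphericalPolynomial c r R, totalDegree_sphericalPolynomial_le c r R,
      fun x hx => ?_, fun x hx y hy => ?_⟩
    · have hxc : ‖x - c‖ ≤ 2 * D + 2 * r := by
        have h1 := norm_sub_le_norm_sub_add_norm_sub x z c
        have h2 := norm_sub_le x z
        linarith [hD x hx, hD z hz]
      rw [polyValue_sphericalPolynomial]
      constructor
      · have h1 : r ≤ ‖x - c‖ := by linarith [he0 x hx]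
        have h2 : r ^ 2 ≤ ‖x - c‖ ^ 2 := by gcongr
        exact div_nonneg (by linarith) hR0.le
      · rw [div_le_one hR0]
        have h2 : ‖x - c‖ ^ 2 ≤ R := by rw [hR]; gcongr
        linarith [sq_nonneg r]
    · have h1 := mul_abs_sqrt_sub_sqrt_le (s := 2 * r) (he0 x hx) (he0 y hy)
      rw [hval, hval, Real.sqrt_div' _ hR0.le, Real.sqrt_div' _ hR0.le, ← sub_div, abs_div,
        abs_of_nonneg (Real.sqrt_nonneg R)]
      set Δ := |√((‖x - c‖ - r) * ((‖x - c‖ - r) + 2 * r)) -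
        √((‖y - c‖ - r) * ((‖y - c‖ - r) + 2 * r))| with hΔ
      have hΔ0 : 0 ≤ Δ := abs_nonneg _
      have h2 : |√(‖x - c‖ - r) - √(‖y - c‖ - r)| ≤ C₂ * (Δ / √R) := by
        have : C₂ * (Δ / √R) = Δ / √(2 * r) := by
          rw [hC₂]
          have := (Real.sqrt_pos.2 hR0).ne'
          field_simp
        rw [this, le_div_iff₀ (Real.sqrt_pos.2 (by positivity)), mul_comm]
        exact h1
      have h3 := herr x hx
      have h4 := herr y hy
      rw [abs_sub_comm] at h4
      have h5 := abs_sub_le (√(Metric.infDist x (frontier Ω))) (√(‖x - c‖ - r))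
        (√(Metric.infDist y (frontier Ω)))
      have h6 := abs_sub_le (√(‖x - c‖ - r)) (√(‖y - c‖ - r))
        (√(Metric.infDist y (frontier Ω)))
      have h7 : 0 ≤ Δ / √R := by positivity
      have h8 := norm_nonneg (x - z)
      have h9 := norm_nonneg (y - z)
      nlinarith [mul_nonneg hC₁0.le h7, mul_nonneg hC₂0.le h8, mul_nonneg hC₂0.le h9,
        mul_nonneg hC₃0.le h7, mul_nonneg hC₃0.le h8, mul_nonneg hC₃0.le h9]
  -- Away from the boundary the change of the square root from its value at `z` is at most `C₃ ‖x -
  -- z‖`, so the norm terms suffice.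
  · refine ⟨0, by simp, fun x _ => by simp [polyValue], fun x hx y hy => ?_⟩
    have key : ∀ x, |√(Metric.infDist z (frontier Ω)) - √(Metric.infDist x (frontier Ω))| ≤
        C₃ * ‖x - z‖ := by
      intro x
      have h1 := abs_sqrt_sub_sqrt_mul_sqrt_le (a := Metric.infDist z (frontier Ω))
        (b := Metric.infDist x (frontier Ω)) Metric.infDist_nonneg Metric.infDist_nonneg
      have h2 := abs_infDist_sub_infDist_le (frontier Ω) z x
      rw [norm_sub_rev] at h2
      have h3 : √(r / 2) ≤ √(Metric.infDist z (frontier Ω)) := Real.sqrt_le_sqrt hzr.le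
      rw [hC₃, one_div, inv_mul_eq_div, le_div_iff₀ (Real.sqrt_pos.2 (by positivity))]
      exact (mul_le_mul_of_nonneg_left h3 (abs_nonneg _)).trans (h1.trans h2)
    have h1 := key x
    have h2 := key y
    rw [abs_sub_comm] at h1
    have h3 := abs_sub_le (√(Metric.infDist x (frontier Ω))) (√(Metric.infDist z (frontier Ω)))
      (√(Metric.infDist y (frontier Ω)))
    have h8 := norm_nonneg (x - z)
    have h9 := norm_nonneg (y - z)
    simp only [polyValue, map_zero, Real.sqrt_zero, sub_zero, abs_zero, zero_add]
    nlinarith [mul_nonneg hC₁0.le h8, mul_nonneg hC₁0.le h9, mul_nonneg hC₂0.le h8,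
      mul_nonneg hC₂0.le h9]

/-! ### Regrouping around a separated set. -/

theorem exists_separated_subset {X : Type*} [DecidableEq X] {ρ : X → X → ℝ} {ε : ℝ}
    (hsymm : ∀ x y, ρ x y = ρ y x) (hself : ∀ x, ρ x x ≤ ε) (Y : Finset X) :
    ∃ S ⊆ Y, (∀ x ∈ S, ∀ y ∈ S, x ≠ y → ε ≤ ρ x y) ∧ ∀ y ∈ Y, ∃ s ∈ S, ρ y s ≤ ε := by
  induction Y using Finset.induction_on with
  | empty => exact ⟨∅, by simp⟩
  | insert a Y ha ih =>
    obtain ⟨S, hSY, hsep, hcov⟩ := ih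
    by_cases h : ∃ s ∈ S, ρ a s ≤ ε
    · refine ⟨S, hSY.trans (Finset.subset_insert _ _), hsep, fun y hy => ?_⟩
      rcases Finset.mem_insert.1 hy with rfl | hy
      · exact h
      · exact hcov y hy
    · push Not at h
      refine ⟨insert a S, Finset.insert_subset_insert _ hSY, fun x hx y hy hxy => ?_,
        fun y hy => ?_⟩
      · rcases Finset.mem_insert.1 hx with hxa | hx <;>
          rcases Finset.mem_insert.1 hy with hya | hy
        · exact absurd (hxa.trans hya.symm) hxy
        · exact hxa ▸ (h y hy).le
        · rw [hsymm]; exact hya ▸ (h x hx).le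
        · exact hsep x hx y hy hxy
      · rcases Finset.mem_insert.1 hy with rfl | hy
        · exact ⟨y, Finset.mem_insert_self _ _, hself y⟩
        · obtain ⟨s, hs, hys⟩ := hcov y hy
          exact ⟨s, Finset.mem_insert_of_mem hs, hys⟩

theorem domainMetric_nonneg {d : ℕ} (Ω : Set (Space d)) (x y : Space d) :
    0 ≤ domainMetric Ω x y := by unfold domainMetric; positivity

theorem domainMetric_self {d : ℕ} (Ω : Set (Space d)) (x : Space d) :
    domainMetric Ω x x = 0 := by simp [domainMetric]

theorem domainMetric_comm {d : ℕ} (Ω : Set (Space d)) (x y : Space d) :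
    domainMetric Ω x y = domainMetric Ω y x := by
  rw [domainMetric, domainMetric, norm_sub_rev, abs_sub_comm]

theorem domainMetric_triangle {d : ℕ} (Ω : Set (Space d)) (x y z : Space d) :
    domainMetric Ω x z ≤ domainMetric Ω x y + domainMetric Ω y z := by
  have h1 := norm_sub_le_norm_sub_add_norm_sub x y z
  have h2 := abs_sub_le (√(Metric.infDist x (frontier Ω))) (√(Metric.infDist y (frontier Ω)))
    (√(Metric.infDist z (frontier Ω)))
  unfold domainMetric
  linarith

theorem polyValue_sum {d : ℕ} {ι : Type*} (s : Finset ι)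
    (P : ι → MvPolynomial (Fin (d + 1)) ℝ) (x : Space d) :
    polyValue (∑ i ∈ s, P i) x = ∑ i ∈ s, polyValue (P i) x := map_sum _ _ _

theorem polyValue_aeval {d : ℕ} (G : MvPolynomial (Fin (d + 1)) ℝ) (q : Polynomial ℝ)
    (x : Space d) : polyValue (Polynomial.aeval G q) x = q.eval (polyValue G x) := by
  rw [polyValue, polyValue, Polynomial.aeval_eq_sum_range, Polynomial.eval_eq_sum_range, map_sum]
  simp [MvPolynomial.smul_eval]

theorem totalDegree_aeval_le {d : ℕ} (G : MvPolynomial (Fin (d + 1)) ℝ) (q : Polynomial ℝ) :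
    (Polynomial.aeval G q).totalDegree ≤ q.natDegree * G.totalDegree := by
  rw [Polynomial.aeval_eq_sum_range]
  refine MvPolynomial.totalDegree_finsetSum_le fun i hi => ?_
  refine (MvPolynomial.totalDegree_smul_le _ _).trans ((MvPolynomial.totalDegree_pow _ _).trans ?_)
  exact Nat.mul_le_mul_right _ (Nat.lt_succ_iff.1 (Finset.mem_range.1 hi))

/-- A polynomial partition of unity whose total mass, weighted by a power of the distance, is
bounded can be regrouped around a separated set of points. -/
theorem exists_separated_partition {d : ℕ} {Ω : Set (Space d)} {ι : Type*} [Fintype ι]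
    (Q : ι → MvPolynomial (Fin (d + 1)) ℝ) (y : ι → Space d) {ℓ A : ℝ} (hℓ : 0 ≤ ℓ) {n D : ℕ}
    (hn : 1 ≤ n) (hy : ∀ i, y i ∈ Ω) (hD : ∀ i, (Q i).totalDegree ≤ D)
    (hsum : ∀ x ∈ Ω, ∑ i, polyValue (Q i) x = 1)
    (hA : ∀ x ∈ Ω, ∑ i, |polyValue (Q i) x| * (1 + n * domainMetric Ω x (y i)) ^ ℓ ≤ A) :
    ∃ (m : ℕ) (p : Fin m → Space d) (P : Fin m → MvPolynomial (Fin (d + 1)) ℝ),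
      (∀ j, p j ∈ Ω) ∧
      (∀ i j, i ≠ j → 1 / (n : ℝ) ≤ domainMetric Ω (p i) (p j)) ∧
      (∀ j, (P j).totalDegree ≤ D) ∧
      (∀ ξ ∈ Ω, ∑ j, polyValue (P j) ξ = 1) ∧
      (∀ ξ ∈ Ω, ∀ j,
        |polyValue (P j) ξ| ≤ 2 ^ ℓ * A * (1 + n * domainMetric Ω ξ (p j)) ^ (-ℓ)) := by
  classical
  have hn0 : (0 : ℝ) < n := by exact_mod_cast hn
  obtain ⟨S, hSY, hsep, hcov⟩ := exists_separated_subset (ρ := domainMetric Ω) (ε := 1 / (n : ℝ))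
    (domainMetric_comm Ω) (fun x => by rw [domainMetric_self]; positivity)
    (Finset.univ.image y)
  -- Each `Q i` goes to a point `g i` of `S` within `1 / n` of `y i`; this move at most doubles `1 +
  -- n ρ`, whence the factor `2 ^ ℓ`.
  choose g hgS hg using fun i => hcov (y i) (Finset.mem_image_of_mem y (Finset.mem_univ i))
  set e := S.equivFin with he
  refine ⟨S.card, fun j => (e.symm j : Space d),
    fun j => ∑ i with g i = (e.symm j : Space d), Q i, fun j => ?_, fun i j hij => ?_, fun j => ?_,
    fun x hx => ?_, fun x hx j => ?_⟩
  · obtain ⟨i, -, hi⟩ := Finset.mem_image.1 (hSY (e.symm j).2)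
    exact (congrArg (· ∈ Ω) hi).mp (hy i)
  · refine hsep _ (e.symm i).2 _ (e.symm j).2 fun hc => hij ?_
    exact e.symm.injective (Subtype.ext hc)
  · exact MvPolynomial.totalDegree_finsetSum_le fun i _ => hD i
  · simp only [polyValue_sum]
    rw [← hsum x hx, Equiv.sum_comp e.symm
      (fun s : S => ∑ i with g i = (s : Space d), polyValue (Q i) x),
      Finset.sum_coe_sort S (fun s => ∑ i with g i = s, polyValue (Q i) x)]
    exact Finset.sum_fiberwise_of_maps_to (fun i _ => hgS i) _
  · set s : Space d := (e.symm j : Space d) with hs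
    have hρ := domainMetric_nonneg Ω x s
    have hpos : 0 < 1 + n * domainMetric Ω x s := by positivity
    rw [Real.rpow_neg hpos.le, ← div_eq_mul_inv, le_div_iff₀ (by positivity), polyValue_sum]
    calc _ ≤ (∑ i with g i = s, |polyValue (Q i) x|) * (1 + n * domainMetric Ω x s) ^ ℓ := by
          gcongr
          exact Finset.abs_sum_le_sum_abs _ _
      _ = ∑ i with g i = s, |polyValue (Q i) x| * (1 + n * domainMetric Ω x s) ^ ℓ := by
          rw [Finset.sum_mul]
      _ ≤ ∑ i with g i = s,
          2 ^ ℓ * (|polyValue (Q i) x| * (1 + n * domainMetric Ω x (y i)) ^ ℓ) := by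
          refine Finset.sum_le_sum fun i hi => ?_
          have hi' : g i = s := (Finset.mem_filter.1 hi).2
          have h1 := domainMetric_triangle Ω x (y i) s
          have h2 := hg i
          rw [hi', le_div_iff₀ hn0] at h2
          have h3 := domainMetric_nonneg Ω x (y i)
          have h4 : 1 + n * domainMetric Ω x s ≤ 2 * (1 + n * domainMetric Ω x (y i)) := by
            nlinarith [mul_le_mul_of_nonneg_left h1 hn0.le, mul_nonneg hn0.le h3]
          have h5 : (1 + n * domainMetric Ω x s) ^ ℓ ≤
              2 ^ ℓ * (1 + n * domainMetric Ω x (y i)) ^ ℓ := by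
            rw [← Real.mul_rpow (by norm_num) (by positivity)]
            exact Real.rpow_le_rpow hpos.le h4 hℓ
          nlinarith [mul_le_mul_of_nonneg_left h5 (abs_nonneg (polyValue (Q i) x))]
      _ ≤ ∑ i, 2 ^ ℓ * (|polyValue (Q i) x| * (1 + n * domainMetric Ω x (y i)) ^ ℓ) := by
          refine Finset.sum_le_sum_of_subset_of_nonneg (Finset.filter_subset _ _) fun i _ _ => ?_
          have h3 := domainMetric_nonneg Ω x (y i)
          positivity
      _ ≤ _ := by
          rw [← Finset.mul_sum]
          gcongr
          exact hA x hx

/-! ### The localized family on the domain. -/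

theorem norm_le_sum_abs {d : ℕ} (x : Space d) : ‖x‖ ≤ ∑ i, |x i| := by
  have h := (EuclideanSpace.basisFun (Fin (d + 1)) ℝ).sum_repr x
  conv_lhs => rw [← h]
  refine (norm_sum_le _ _).trans (le_of_eq (Finset.sum_congr rfl fun i _ => ?_))
  rw [norm_smul, OrthonormalBasis.norm_eq_one, mul_one, Real.norm_eq_abs]
  rfl

theorem one_add_sum_le_prod {ι : Type*} (s : Finset ι) (f : ι → ℝ) (hf : ∀ i, 0 ≤ f i) :
    1 + ∑ i ∈ s, f i ≤ ∏ i ∈ s, (1 + f i) := by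
  classical
  induction s using Finset.induction_on with
  | empty => simp
  | insert a s ha ih =>
    rw [Finset.sum_insert ha, Finset.prod_insert ha]
    nlinarith [hf a, Finset.sum_nonneg fun i (_ : i ∈ s) => hf i]

open MvPolynomial in
/-- The affine change of coordinates which maps `[-R, R]` onto `[0, 1]`. -/
noncomputable def rescaledCoordinate {d : ℕ} (R : ℝ) (a : Fin (d + 1)) :
    MvPolynomial (Fin (d + 1)) ℝ :=
  C (2 * R)⁻¹ * (X a + C R)

theorem polyValue_rescaledCoordinate {d : ℕ} (R : ℝ) (a : Fin (d + 1)) (x : Space d) :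
    polyValue (rescaledCoordinate R a) x = (x a + R) / (2 * R) := by
  simp [polyValue, rescaledCoordinate, div_eq_inv_mul]

theorem totalDegree_rescaledCoordinate_le {d : ℕ} (R : ℝ) (a : Fin (d + 1)) :
    (rescaledCoordinate R a).totalDegree ≤ 1 := by
  refine (MvPolynomial.totalDegree_mul _ _).trans ?_
  rw [MvPolynomial.totalDegree_C, zero_add]
  exact (MvPolynomial.totalDegree_add _ _).trans (max_le (by simp) (by simp))

/-- A polynomial partition of unity on a `C²` domain which is localized at the scale `1 / n` with
respect to `domainMetric`. -/
theorem IsClosedC2Domain.exists_localized_family {d : ℕ} {Ω : Set (Space d)}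
    (h : IsClosedC2Domain Ω) (p : ℕ) :
    ∃ A : ℝ, 0 < A ∧ ∀ n : ℕ, 1 ≤ n → ∃ (N : ℕ)
      (Q : (Fin (d + 1) → Fin N) × Fin N → MvPolynomial (Fin (d + 1)) ℝ)
      (y : (Fin (d + 1) → Fin N) × Fin N → Space d),
      (∀ i, y i ∈ Ω) ∧ (∀ i, (Q i).totalDegree ≤ (d + 3) * (p + 1) * n) ∧
      (∀ x ∈ Ω, ∑ i, polyValue (Q i) x = 1) ∧
      ∀ x ∈ Ω, ∑ i, |polyValue (Q i) x| * (1 + n * domainMetric Ω x (y i)) ^ (2 * p) ≤ A := by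
  obtain ⟨C, hC, hquad⟩ := h.exists_quadratic
  obtain ⟨R, hR0, hR⟩ := h.isCompact.isBounded.exists_pos_norm_le
  -- The second summand is the constant needed in `hρ`; the added `1` gives `B ≥ 1`, so `B` also
  -- factors out of `1 + n ρ`.
  set B : ℝ := 1 + 2 * (1 + C) * (8 * R + 1) with hB
  have hB1 : 1 ≤ B := by
    rw [hB, le_add_iff_nonneg_right]
    positivity
  set A₀ : ℝ := 4 ^ p * (p + 2) with hA₀
  have hA₀0 : 0 < A₀ := by positivity
  refine ⟨B ^ (2 * p) * (A₀ ^ (d + 1) * A₀), by positivity, fun n hn => ?_⟩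
  obtain ⟨N, q, τ, hq, hτ, hpart⟩ := exists_localized_partition p n hn
  have hn0 : (0 : ℝ) < n := by exact_mod_cast hn
  have ht : ∀ x ∈ Ω, ∀ a, (x a + R) / (2 * R) ∈ Set.Icc (0 : ℝ) 1 := by
    intro x hx a
    have h1 := (PiLp.norm_apply_le x a).trans (hR x hx)
    rw [Real.norm_eq_abs, abs_le] at h1
    constructor
    · exact div_nonneg (by linarith) (by linarith)
    · rw [div_le_one (by linarith)]; linarith
  set z : (Fin (d + 1) → Fin N) → Space d :=
    fun i => WithLp.toLp 2 fun a => 2 * R * τ (i a) ^ 2 - R with hz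
  set s : (Fin (d + 1) → Fin N) → Space d → Fin (d + 1) → ℝ :=
    fun i x a => |√((x a + R) / (2 * R)) - τ (i a)| with hs
  have hxz : ∀ i, ∀ x ∈ Ω, ‖x - z i‖ ≤ 4 * R * ∑ a, s i x a := by
    intro i x hx
    refine (norm_le_sum_abs _).trans ?_
    rw [Finset.mul_sum]
    refine Finset.sum_le_sum fun a _ => ?_
    obtain ⟨h0, h1⟩ := ht x hx a
    have h2 := Real.sq_sqrt h0
    have h3 : (x - z i) a = (√((x a + R) / (2 * R)) - τ (i a)) *
        (2 * R * (√((x a + R) / (2 * R)) + τ (i a))) := by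
      have h4 : 2 * R * √((x a + R) / (2 * R)) ^ 2 = x a + R := by rw [h2]; field_simp
      have h5 : (x - z i) a = x a - (2 * R * τ (i a) ^ 2 - R) := rfl
      rw [h5]
      linarith
    have h6 := Real.sqrt_nonneg ((x a + R) / (2 * R))
    have h7 : √((x a + R) / (2 * R)) ≤ 1 := Real.sqrt_le_one.2 h1
    obtain ⟨h8, h9⟩ := hτ (i a)
    rw [h3, abs_mul, mul_comm, abs_of_nonneg (a := 2 * R * _) (by positivity)]
    refine mul_le_mul_of_nonneg_right ?_ (abs_nonneg _)
    nlinarith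
  -- The grid point `z i` may lie outside `Ω`. Its nearest point in `Ω` is at most twice as far from
  -- any `x ∈ Ω`, so `4 R` becomes `8 R`.
  choose w hwΩ hw using fun i => h.isCompact.exists_infDist_eq_dist h.nonempty (z i)
  have hxw : ∀ i, ∀ x ∈ Ω, ‖x - w i‖ ≤ 8 * R * ∑ a, s i x a := by
    intro i x hx
    have h1 := Metric.infDist_le_dist_of_mem (x := z i) hx
    rw [hw i, dist_eq_norm, dist_eq_norm, norm_sub_rev (z i) x] at h1
    have h2 := norm_sub_le_norm_sub_add_norm_sub x (z i) (w i)
    have h3 := hxz i x hx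
    linarith
  choose G hGd hG hGρ using fun i => hquad (w i) (hwΩ i)
  have hGcont : ∀ i, Continuous fun x : Space d => polyValue (G i) x := fun i =>
    (MvPolynomial.continuous_eval (G i)).comp (by fun_prop)
  -- There may be no point of `Ω` near `w` with `√G = τ`. A minimizer of the total deviation serves
  -- as centre: its deviation is at most that of any `x`, which costs only a factor `2`.
  have hmin : ∀ i : (Fin (d + 1) → Fin N) × Fin N, ∃ y ∈ Ω, ∀ x ∈ Ω,
      ‖y - w i.1‖ + |√(polyValue (G i.1) y) - τ i.2| ≤
        ‖x - w i.1‖ + |√(polyValue (G i.1) x) - τ i.2| := by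
    intro i
    refine h.isCompact.exists_isMinOn h.nonempty (f := fun x =>
      ‖x - w i.1‖ + |√(polyValue (G i.1) x) - τ i.2|) (Continuous.continuousOn ?_)
    have := hGcont i.1
    fun_prop
  choose y hyΩ hy using hmin
  have hρ : ∀ i, ∀ x ∈ Ω, domainMetric Ω x (y i) ≤
      B * (∑ a, s i.1 x a + |√(polyValue (G i.1) x) - τ i.2|) := by
    intro i x hx
    have h1 := hGρ i.1 x hx (y i) (hyΩ i)
    have h2 := hy i x hx
    have h3 := hxw i.1 x hx
    have h4 := norm_sub_le_norm_sub_add_norm_sub x (w i.1) (y i)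
    rw [norm_sub_rev (w i.1)] at h4
    have h5 := abs_sub_le (√(polyValue (G i.1) x)) (τ i.2) (√(polyValue (G i.1) (y i)))
    rw [abs_sub_comm (τ i.2)] at h5
    set U := |√(polyValue (G i.1) x) - τ i.2|
    set V := |√(polyValue (G i.1) (y i)) - τ i.2|
    have hU : 0 ≤ U := abs_nonneg _
    have hS0 : 0 ≤ ∑ a, s i.1 x a := Finset.sum_nonneg fun a _ => abs_nonneg _
    have h6 : domainMetric Ω x (y i) ≤
        (1 + C) * ((‖x - w i.1‖ + U) + (‖y i - w i.1‖ + V)) := by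
      have hV : 0 ≤ V := abs_nonneg _
      have h7 := mul_le_mul_of_nonneg_left h5 hC.le
      unfold domainMetric
      linarith
    have h8 : (1 + C) * ((‖x - w i.1‖ + U) + (‖y i - w i.1‖ + V)) ≤
        (1 + C) * (2 * (8 * R * ∑ a, s i.1 x a + U)) := by
      gcongr
      linarith
    have h9 : 0 ≤ (1 + C) * R * U := by positivity
    have h10 : 0 ≤ (1 + C) * ∑ a, s i.1 x a := by positivity
    rw [hB]
    linarith
  have hweight : ∀ i, ∀ x ∈ Ω, (1 + n * domainMetric Ω x (y i)) ^ (2 * p) ≤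
      B ^ (2 * p) * ((∏ a, (1 + n * s i.1 x a) ^ (2 * p)) *
        (1 + n * |√(polyValue (G i.1) x) - τ i.2|) ^ (2 * p)) := by
    intro i x hx
    have h0 := domainMetric_nonneg Ω x (y i)
    rw [Finset.prod_pow, ← mul_pow, ← mul_pow]
    refine pow_le_pow_left₀ (by positivity) ?_ _
    set U := |√(polyValue (G i.1) x) - τ i.2| with hUdef
    have hU : 0 ≤ U := abs_nonneg _
    have hs0 : ∀ a, 0 ≤ n * s i.1 x a := fun a => mul_nonneg hn0.le (abs_nonneg _)
    have h1 := one_add_sum_le_prod Finset.univ (fun a => n * s i.1 x a) hs0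
    rw [← Finset.mul_sum] at h1
    have hS0 : 0 ≤ ∑ a, s i.1 x a := Finset.sum_nonneg fun a _ => abs_nonneg _
    have h2 := mul_le_mul_of_nonneg_left (hρ i x hx) hn0.le
    calc _ ≤ B * ((1 + n * ∑ a, s i.1 x a) * (1 + n * U)) := by
          have h3 : 0 ≤ B * ((n * ∑ a, s i.1 x a) * (n * U)) := by positivity
          linarith
      _ ≤ _ := by gcongr
  -- The quadratic `G i.1` depends only on the coordinate indices, so for each of these the last
  -- factors still sum to `1`. The degree count is `d + 1` linear substitutions and one quadratic,
  -- `d + 3` in total.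
  refine ⟨N, fun i => (∏ a, Polynomial.aeval (rescaledCoordinate R a) (q (i.1 a))) *
    Polynomial.aeval (G i.1) (q i.2), y, hyΩ, fun i => ?_, fun x hx => ?_, fun x hx => ?_⟩
  · refine (MvPolynomial.totalDegree_mul _ _).trans ?_
    have h1 : (∏ a, Polynomial.aeval (rescaledCoordinate R a) (q (i.1 a)) :
        MvPolynomial (Fin (d + 1)) ℝ).totalDegree ≤ ∑ a : Fin (d + 1), (p + 1) * n := by
      refine (MvPolynomial.totalDegree_finsetProd _ _).trans (Finset.sum_le_sum fun a _ => ?_)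
      refine (totalDegree_aeval_le _ _).trans ?_
      exact (Nat.mul_le_mul (hq _) (totalDegree_rescaledCoordinate_le R a)).trans
        (mul_one _).le
    have h2 := (totalDegree_aeval_le (G i.1) (q i.2)).trans (Nat.mul_le_mul (hq _) (hGd i.1))
    rw [Finset.sum_const, Finset.card_univ, Fintype.card_fin, smul_eq_mul] at h1
    calc _ ≤ (d + 1) * ((p + 1) * n) + (p + 1) * n * 2 := add_le_add h1 h2
      _ = _ := by ring
  all_goals
    have hval : ∀ i : (Fin (d + 1) → Fin N) × Fin N,
        polyValue ((∏ a, Polynomial.aeval (rescaledCoordinate R a) (q (i.1 a))) *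
          Polynomial.aeval (G i.1) (q i.2)) x =
        (∏ a, (q (i.1 a)).eval ((x a + R) / (2 * R))) *
          (q i.2).eval (polyValue (G i.1) x) := by
      intro i
      rw [← polyValue_aeval, polyValue, map_mul, map_prod]
      congr 1
      refine Finset.prod_congr rfl fun a _ => ?_
      rw [← polyValue_rescaledCoordinate, ← polyValue_aeval]
      rfl
    simp only [hval]
  · rw [Fintype.sum_prod_type]
    simp only [← Finset.mul_sum, (hpart _ (hG _ x hx)).1, mul_one]
    rw [← Fintype.piFinset_univ,
      ← Finset.prod_univ_sum _ fun a k => (q k).eval ((x a + R) / (2 * R))]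
    exact Finset.prod_eq_one fun a _ => (hpart _ (ht x hx a)).1
  · set F : Fin (d + 1) → Fin N → ℝ := fun a k => |(q k).eval ((x a + R) / (2 * R))| *
      (1 + n * |√((x a + R) / (2 * R)) - τ k|) ^ (2 * p) with hF
    set H : (Fin (d + 1) → Fin N) → Fin N → ℝ := fun i k => |(q k).eval (polyValue (G i) x)| *
      (1 + n * |√(polyValue (G i) x) - τ k|) ^ (2 * p) with hH
    have hF0 : ∀ a k, 0 ≤ F a k := fun a k => by positivity
    calc _ ≤ ∑ i : (Fin (d + 1) → Fin N) × Fin N,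
          B ^ (2 * p) * ((∏ a, F a (i.1 a)) * H i.1 i.2) := by
          refine Finset.sum_le_sum fun i _ => ?_
          refine (mul_le_mul_of_nonneg_left (hweight i x hx) (abs_nonneg _)).trans (le_of_eq ?_)
          rw [abs_mul, Finset.abs_prod, hF, hH, Finset.prod_mul_distrib]
          ring
      _ = B ^ (2 * p) * ∑ i : Fin (d + 1) → Fin N, (∏ a, F a (i a)) * ∑ k, H i k := by
          rw [← Finset.mul_sum, Fintype.sum_prod_type]
          simp only [Finset.mul_sum]
      -- The univariate bound is uniform in `t ∈ [0, 1]`, so it applies with the same `A₀` whichever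
      -- `G i` occurs; the remaining sum is then a product over coordinates.
      _ ≤ B ^ (2 * p) * ∑ i : Fin (d + 1) → Fin N, (∏ a, F a (i a)) * A₀ := by
          gcongr with i
          exact (hpart _ (hG i x hx)).2
      _ = B ^ (2 * p) * ((∏ a, ∑ k, F a k) * A₀) := by
          rw [← Finset.sum_mul, Finset.prod_univ_sum, Fintype.piFinset_univ]
      _ ≤ B ^ (2 * p) * (A₀ ^ (d + 1) * A₀) := by
          gcongr
          calc _ ≤ ∏ _a : Fin (d + 1), A₀ := Finset.prod_le_prod
                (fun a _ => Finset.sum_nonneg fun k _ => hF0 a k)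
                (fun a _ => (hpart _ (ht x hx a)).2)
            _ = _ := by simp

/-! ### The theorem. -/

theorem mainTheorem3 (d : ℕ) (ℓ : ℝ) (hℓ : 1 < ℓ) :
    ∃ c₀ : ℝ, 0 < c₀ ∧
      ∀ Ω : Set (Space d), IsClosedC2Domain Ω →
        ∃ C : ℝ, 0 < C ∧
          ∀ n : ℕ, 1 ≤ n →
            ∃ (m : ℕ) (p : Fin m → Space d) (P : Fin m → MvPolynomial (Fin (d + 1)) ℝ),
              (∀ j, p j ∈ Ω) ∧
              (∀ i j, i ≠ j → 1 / (n : ℝ) ≤ domainMetric Ω (p i) (p j)) ∧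
              (∀ j, ((P j).totalDegree : ℝ) ≤ c₀ * n) ∧
              (∀ ξ ∈ Ω, ∑ j, polyValue (P j) ξ = 1) ∧
              (∀ ξ ∈ Ω, ∀ j,
                |polyValue (P j) ξ| ≤ C * (1 + n * domainMetric Ω ξ (p j)) ^ (-ℓ)) := by
  -- The family has moments of order `2 p ≥ ℓ`, and `p` depends only on `ℓ`, so the degree constant
  -- does not see `Ω`.
  obtain ⟨p, hp⟩ := exists_nat_ge ℓ
  refine ⟨((d + 3) * (p + 1) : ℕ), by positivity, fun Ω hΩ => ?_⟩
  obtain ⟨A, hA, hfam⟩ := hΩ.exists_localized_family p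
  refine ⟨2 ^ ℓ * A, by positivity, fun n hn => ?_⟩
  obtain ⟨N, Q, y, hy, hQ, hsum, hmom⟩ := hfam n hn
  obtain ⟨m, ξ, P, h1, h2, h3, h4, h5⟩ := exists_separated_partition Q y (ℓ := ℓ) (A := A)
    (by linarith) hn hy hQ hsum fun x hx => by
      refine le_trans (Finset.sum_le_sum fun i _ => ?_) (hmom x hx)
      have h0 := domainMetric_nonneg Ω x (y i)
      gcongr
      rw [← Real.rpow_natCast]
      refine Real.rpow_le_rpow_of_exponent_le (by simp; positivity) ?_
      push_cast
      linarith
  exact ⟨m, ξ, P, h1, h2, fun j => by exact_mod_cast h3 j, h4, h5⟩
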